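/- Setting. Let $E$ be a measurable space, $\Pi$ a Markov kernel on $E$ and $0<\alpha<1$. Let $X=(X_n)_{n\ge 0}$ be a time-homogeneous Markov process with kernel $\Pi$ and $X_0=x$ under $\mathbb P_x$, $x\in E$. Let $\xi^{(i)}_n$ ($i=1,2$, $n\ge 0$) be i.i.d. uniform on $(0,1)$ and independent of $X$. An admissible stopping time of player $i$ is a stopping time (with values in $\{0,1,\dots\}\cup\{\infty\}$) for the filtration $\sigma(X_0,\dots,X_n,\xi^{(i)}_0,\dots,\xi^{(i)}_n)$, $n\ge 0$. For measurable $f,g,h:E\to\mathbb R$, consider the symmetric game in which player $i$, against the opponent $j\ne i$, has the expected reward $$J_i(x;\tau_1,\tau_2)=\mathbb E_x\big[\alpha^{\tau_i}f(X_{\tau_i})\mathbf 1_{\{\tau_i<\tau_j\}}+\alpha^{\tau_j}g(X_{\tau_j})\mathbf 1_{\{\tau_j<\tau_i\}}+\alpha^{\tau_i}h(X_{\tau_i})\mathbf 1_{\{\tau_i=\tau_j<\infty\}}\big].$$ Let $\tilde X$ be $X$ killed at each time $n\ge 1$ with probability $1-\alpha$, independently of $X$ (functions vanish at the cemetery state),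 and assume that $\sup_n|f(\tilde X_n)|$, $\sup_n|g(\tilde X_n)|$ and $\sup_n|h(\tilde X_n)|$ are integrable under every $\mathbb P_x$. For measurable $p^{(i)}:E\to[0,1]$ put $\tau^{p^{(i)}}=\inf\{n\ge 0: p^{(i)}(X_n)\ge\xi^{(i)}_n\}$, with $\inf\emptyset=\infty$. The pair $(p^{(1)},p^{(2)})$ is a global Markovian equilibrium if for every $x\in E$ the pair $(\tau^{p^{(1)}},\tau^{p^{(2)}})$ is a Nash equilibrium, i.e. for each player $i$ the number $J_i(x;\tau^{p^{(1)}},\tau^{p^{(2)}})$ is the supremum of the rewards of player $i$ over all admissible stopping times of player $i$, the opponent's stopping time being fixed. Its values are $V^{(i)}(x)=J_i(x;\tau^{p^{(1)}},\tau^{p^{(2)}})$. Write $\Pi f(x)=\int f(y)\,\Pi(x,dy)$. Statement. Suppose that $f$ is strictly $\alpha$-excessive, i.e. $\alpha\Pi f(x)<f(x)$ for all $x\in E$, and that $g(x)>f(x)=h(x)$ for all $x\in E$. Then, for all $x\in E$, $$p(x)=\frac{f(x)-\alpha\Pi f(x)}{g(x)-\alpha\Pi f(x)}\in(0,1),$$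 and $(p^{(1)},p^{(2)})$ with $p^{(1)}=p^{(2)}=p$ is a (symmetric) global Markovian equilibrium with values $V^{(1)}=V^{(2)}=f$. -/

import Mathlib

open MeasureTheory ProbabilityTheory

/-- The probabilistic setting of a discounted two-player Markovian stopping game on the state
space `E`, with discount factor `α` and Markov kernel `K`: a measurable space `Ω` with a family of
probability measures `P x`, `x : E`, carrying

* a time-homogeneous Markov process `X` with transition kernel `K`, started in `x` under `P x`;
* for each player `i : Fin 2` a sequence `ξ i` of randomization devices; all of them are i.i.d.
  uniform on `(0,1)` and independent of the process `X`;
* a killing mechanism: `lifetime` is the last time before killing. It is independent of `X`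
  and geometric, `P (lifetime = k) = (1 - α) α ^ k`, i.e. at each time `n ≥ 1` a process which is
  still alive is killed with probability `1 - α`. -/
structure MarkovGameModel (E Ω : Type*) [MeasurableSpace E] [MeasurableSpace Ω]
    (α : ℝ) (K : Kernel E E) where
  P : E → Measure Ω
  isProbabilityMeasure : ∀ x, IsProbabilityMeasure (P x)
  X : ℕ → Ω → E
  measurable_X : ∀ n, Measurable (X n)
  initial : ∀ x, (P x).map (X 0) = Measure.dirac x
  markov : ∀ (x : E) (n : ℕ) (B : Set E), MeasurableSet B →
    (P x)[(X (n + 1) ⁻¹' B).indicator (fun _ => (1 : ℝ)) |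
        ⨆ k ≤ n, MeasurableSpace.comap (X k) inferInstance]
      =ᵐ[P x] fun ω => (K (X n ω) B).toReal
  ξ : Fin 2 → ℕ → Ω → ℝ
  measurable_ξ : ∀ i n, Measurable (ξ i n)
  uniform_ξ : ∀ x i n, pdf.IsUniform (ξ i n) (Set.Ioo (0 : ℝ) 1) (P x)
  indep_ξ : ∀ x, iIndepFun (fun k : Fin 2 × ℕ => ξ k.1 k.2) (P x)
  indep_X_ξ : ∀ x, IndepFun (fun ω n => X n ω) (fun ω (k : Fin 2 × ℕ) => ξ k.1 k.2 ω) (P x)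
  lifetime : Ω → ℕ
  measurable_lifetime : Measurable lifetime
  law_lifetime : ∀ x k, P x {ω | lifetime ω = k} = ENNReal.ofReal ((1 - α) * α ^ k)
  indep_X_lifetime : ∀ x, IndepFun (fun ω n => X n ω) lifetime (P x)

namespace MarkovGameModel

variable {E Ω : Type*} [MeasurableSpace E] [mΩ : MeasurableSpace Ω] {α : ℝ} {K : Kernel E E}

/-- The killed process; `none` is the cemetery state. -/
def killed (M : MarkovGameModel E Ω α K) (n : ℕ) (ω : Ω) : Option E :=
  if n ≤ M.lifetime ω then some (M.X n ω) else none

/-- Extension of a function to the cemetery state by the value `0`. -/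
def extendZero (u : E → ℝ) (y : Option E) : ℝ := y.elim 0 u

/-- For every starting point, the supremum of `|u|` along the killed process is in `L¹`.
(Every path is killed in finite time, so this supremum is over a bounded set.) -/
def SupIntegrable (M : MarkovGameModel E Ω α K) (u : E → ℝ) : Prop :=
  ∀ x, Integrable (fun ω => ⨆ n : ℕ, |extendZero u (M.killed n ω)|) (M.P x)

/-- The information of player `i`: at time `n` it is
`σ(X 0, …, X n, ξ i 0, …, ξ i n)`. -/
def filtration (M : MarkovGameModel E Ω α K) (i : Fin 2) : Filtration ℕ mΩ where
  seq n := ⨆ k ≤ n, (MeasurableSpace.comap (M.X k) inferInstance ⊔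
    MeasurableSpace.comap (M.ξ i k) inferInstance)
  mono' _ _ hmn := iSup₂_mono' fun k hk => ⟨k, hk.trans hmn, le_rfl⟩
  le' _ := iSup₂_le fun k _ =>
    sup_le (M.measurable_X k).comap_le (M.measurable_ξ i k).comap_le

/-- Admissible stopping times of player `i` (possibly taking the value `∞`). -/
def Admissible (M : MarkovGameModel E Ω α K) (i : Fin 2) (τ : Ω → ℕ∞) : Prop :=
  IsStoppingTime (M.filtration i) τ

/-- The Markovian randomized stopping time of player `i` given by `p : E → [0,1]`:
`inf {n | p (X n) ≥ ξ i n}`, with `inf ∅ = ∞`. -/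
noncomputable def markovTime (M : MarkovGameModel E Ω α K) (i : Fin 2) (p : E → ℝ) (ω : Ω) : ℕ∞ :=
  ⨅ (n : ℕ) (_ : p (M.X n ω) ≥ M.ξ i n ω), (n : ℕ∞)

/-- The discounted reward of a player with payoff functions `f`, `g`, `h` who stops at `σ` while
the opponent stops at `τ`: `f` for stopping first, `g` for stopping second, `h` for stopping
simultaneously, and `0` if nobody ever stops. -/
noncomputable def reward (M : MarkovGameModel E Ω α K) (f g h : E → ℝ) (σ τ : Ω → ℕ∞) (ω : Ω) :
    ℝ :=
  if σ ω < τ ω then α ^ (σ ω).toNat * f (M.X (σ ω).toNat ω)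
  else if τ ω < σ ω then α ^ (τ ω).toNat * g (M.X (τ ω).toNat ω)
  else if σ ω < ⊤ then α ^ (σ ω).toNat * h (M.X (σ ω).toNat ω)
  else 0

/-- The expected reward `J i (x; τ 0, τ 1)` of player `i` in the game started at `x`, where
`f j`, `g j`, `h j` are the payoff functions of player `j`; the opponent of `i` is `Fin.rev i`. -/
noncomputable def J (M : MarkovGameModel E Ω α K) (f g h : Fin 2 → E → ℝ) (i : Fin 2) (x : E)
    (τ : Fin 2 → Ω → ℕ∞) : ℝ :=
  ∫ ω, M.reward (f i) (g i) (h i) (τ i) (τ i.rev) ω ∂(M.P x)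

/-- Nash equilibrium for the starting point `x`: both stopping times are admissible, and each
player's expected reward is the supremum of those attainable by unilateral deviation to an
admissible stopping time. -/
def IsNashEquilibrium (M : MarkovGameModel E Ω α K) (f g h : Fin 2 → E → ℝ) (x : E)
    (τ : Fin 2 → Ω → ℕ∞) : Prop :=
  ∀ i, M.Admissible i (τ i) ∧
    IsLUB {r | ∃ σ, M.Admissible i σ ∧ r = M.J f g h i x (Function.update τ i σ)}
      (M.J f g h i x τ)

/-- Global Markovian randomized equilibrium: a pair of measurable functions `p i : E → [0,1]`
whose Markovian randomized stopping times form a Nash equilibrium for every starting point. -/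
def IsGlobalMarkovianEquilibrium (M : MarkovGameModel E Ω α K) (f g h : Fin 2 → E → ℝ)
    (p : Fin 2 → E → ℝ) : Prop :=
  (∀ i, Measurable (p i)) ∧ (∀ i x, p i x ∈ Set.Icc (0 : ℝ) 1) ∧
    ∀ x, M.IsNashEquilibrium f g h x (fun i => M.markovTime i (p i))

/-- The values `V i x` of a pair of Markovian strategies. -/
noncomputable def value (M : MarkovGameModel E Ω α K) (f g h : Fin 2 → E → ℝ) (p : Fin 2 → E → ℝ)
    (i : Fin 2) (x : E) : ℝ :=
  M.J f g h i x (fun j => M.markovTime j (p j))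

end MarkovGameModel

/-- The action of a kernel on functions, `(K f)(x) = ∫ f(y) K(x, dy)`. -/
noncomputable def kernelAction {E : Type*} [MeasurableSpace E] (K : Kernel E E) (f : E → ℝ)
    (x : E) : ℝ :=
  ∫ y, f y ∂(K x)

/-- `f` is strictly `α`-excessive for `K`. -/
def StrictlyExcessive {E : Type*} [MeasurableSpace E] (α : ℝ) (K : Kernel E E) (f : E → ℝ) :
    Prop :=
  ∀ x, α * kernelAction K f x < f x

/-! Suppose the opponent stops at each state `y` with probability `p y`. Stopping now pays `f y`
whether or not the opponent stops too, because `h = f`. Waiting one step and then stopping is worth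
`p y * g y + (1 - p y) * (α * kernelAction K f y)`, and `p` is the solution of the equation making
this equal to `f y`. Hence a player is indifferent at every time, every admissible time earns
exactly `f x` from `x`, and any reply, in particular `p` itself, is a best one. Strict excessivity
and `f < g` only serve to place `p` in `(0, 1)`.

To make this rigorous, `σ` is truncated at a deterministic `N`. Passing from `N` to `N + 1` changes
the expected reward by zero (`integral_increment_eq_zero`): the opponent's device at time `N` is
independent of the trajectory and of all other devices, and `X (N + 1)` is governed by the kernel
given the past. Dominated convergence removes the truncation; the dominating function is the
discounted sum of `|f|` and `|g|` along the path, integrable by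
`SupIntegrable.lintegral_tsum_lt_top`. -/

namespace MarkovGameModel

open Set Filter Topology
open scoped ENNReal

variable {E Ω : Type*} [MeasurableSpace E] [mΩ : MeasurableSpace Ω] {α : ℝ} {K : Kernel E E}

/-! ### Integrability from the killed process -/

/-- Along a path killed in finite time, the supremum of `|u|` dominates `|u|` at the last time
before killing. -/
lemma abs_le_iSup_killed (M : MarkovGameModel E Ω α K) (u : E → ℝ) (ω : Ω) :
    |u (M.X (M.lifetime ω) ω)| ≤ ⨆ n : ℕ, |extendZero u (M.killed n ω)| := by
  have hfin : (range fun n : ℕ => |extendZero u (M.killed n ω)|).Finite := by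
    refine ((finite_Iic (M.lifetime ω)).image
      (fun n => |u (M.X n ω)|) |>.union (finite_singleton (0 : ℝ))).subset ?_
    rintro _ ⟨n, rfl⟩
    by_cases h : n ≤ M.lifetime ω
    · exact Or.inl ⟨n, h, by simp [killed, extendZero, h]⟩
    · exact Or.inr (by simp [killed, extendZero, h])
  simpa [killed, extendZero] using le_ciSup hfin.bddAbove (M.lifetime ω)

/-- Integrability of the supremum along the killed process makes the discounted sum of `|u|`
along the original process integrable. -/
lemma SupIntegrable.lintegral_tsum_lt_top {M : MarkovGameModel E Ω α K} {u : E → ℝ}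
    (hα0 : 0 < α) (hα1 : α < 1) (hu : Measurable u) (h : M.SupIntegrable u) (x : E) :
    ∫⁻ ω, ∑' n : ℕ, ENNReal.ofReal (α ^ n * |u (M.X n ω)|) ∂(M.P x) < ∞ := by
  have hX := M.measurable_X
  have hL := M.measurable_lifetime
  set S : Ω → ℝ := fun ω => ⨆ n : ℕ, |extendZero u (M.killed n ω)|
  have hpos : 0 < 1 - α := sub_pos.2 hα1
  -- The weight `(1 - α) * α ^ n` is the probability of `lifetime = n`, so up to the factor `1 - α`
  -- the discounted sum has the expectation of `|u|` at the last time before killing.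
  have hterm (n : ℕ) : ENNReal.ofReal (1 - α) *
      ∫⁻ ω, ENNReal.ofReal (α ^ n * |u (M.X n ω)|) ∂(M.P x) =
      ∫⁻ ω, ENNReal.ofReal |u (M.X n ω)| * (M.lifetime ⁻¹' {n}).indicator 1 ω ∂(M.P x) := by
    have hind : IndepFun (fun ω => ENNReal.ofReal |u (M.X n ω)|)
        (fun ω => (M.lifetime ⁻¹' {n}).indicator (1 : Ω → ℝ≥0∞) ω) (M.P x) :=
      (M.indep_X_lifetime x).comp (φ := fun a : ℕ → E => ENNReal.ofReal |u (a n)|)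
        (ψ := fun k => ({n} : Set ℕ).indicator (1 : ℕ → ℝ≥0∞) k) (by fun_prop)
        (measurable_of_countable _)
    rw [lintegral_mul_eq_lintegral_mul_lintegral_of_indepFun'' (by fun_prop)
      ((measurable_one.indicator (hL (measurableSet_singleton n))).aemeasurable) hind,
      lintegral_indicator_one (hL (measurableSet_singleton n))]
    have : M.P x (M.lifetime ⁻¹' {n}) = ENNReal.ofReal ((1 - α) * α ^ n) := M.law_lifetime x n
    rw [this, ENNReal.ofReal_mul hpos.le]
    simp_rw [ENNReal.ofReal_mul (pow_nonneg hα0.le n)]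
    rw [lintegral_const_mul _ (by fun_prop)]
    ring
  have hle : ENNReal.ofReal (1 - α) *
      ∫⁻ ω, ∑' n : ℕ, ENNReal.ofReal (α ^ n * |u (M.X n ω)|) ∂(M.P x) ≤
      ∫⁻ ω, ENNReal.ofReal (S ω) ∂(M.P x) := by
    rw [lintegral_tsum (fun n => by fun_prop), ← ENNReal.tsum_mul_left]
    simp_rw [hterm]
    have hm (n : ℕ) : Measurable fun ω => ENNReal.ofReal |u (M.X n ω)| *
        (M.lifetime ⁻¹' {n}).indicator (1 : Ω → ℝ≥0∞) ω :=
      Measurable.mul (by fun_prop) (measurable_one.indicator (hL (measurableSet_singleton n)))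
    rw [← lintegral_tsum fun n => (hm n).aemeasurable]
    refine lintegral_mono fun ω => ?_
    rw [tsum_eq_single (M.lifetime ω) (fun n hn => by simp [hn.symm])]
    simpa using ENNReal.ofReal_le_ofReal (M.abs_le_iSup_killed u ω)
  have hS : ∫⁻ ω, ENNReal.ofReal (S ω) ∂(M.P x) < ∞ := (h x).lintegral_lt_top
  refine lt_of_not_ge fun htop => ?_
  rw [top_le_iff] at htop
  rw [htop, ENNReal.mul_top (by simpa using hpos)] at hle
  exact absurd hS (not_lt.2 hle)

lemma SupIntegrable.ae_summable {M : MarkovGameModel E Ω α K} {u : E → ℝ}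
    (hα0 : 0 < α) (hα1 : α < 1) (hu : Measurable u) (h : M.SupIntegrable u) (x : E) :
    ∀ᵐ ω ∂(M.P x), Summable fun n : ℕ => α ^ n * |u (M.X n ω)| := by
  have hX := M.measurable_X
  filter_upwards [ae_lt_top (by fun_prop) (h.lintegral_tsum_lt_top hα0 hα1 hu x).ne] with ω hω
  have := ENNReal.summable_toReal hω.ne
  refine this.congr fun n => ?_
  rw [ENNReal.toReal_ofReal (by positivity)]

lemma SupIntegrable.integrable_tsum {M : MarkovGameModel E Ω α K} {u : E → ℝ}
    (hα0 : 0 < α) (hα1 : α < 1) (hu : Measurable u) (h : M.SupIntegrable u) (x : E) :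
    Integrable (fun ω => ∑' n : ℕ, α ^ n * |u (M.X n ω)|) (M.P x) := by
  have hX := M.measurable_X
  have hlt := h.lintegral_tsum_lt_top hα0 hα1 hu x
  refine (integrable_toReal_of_lintegral_ne_top (by fun_prop) hlt.ne).congr ?_
  filter_upwards with ω
  rw [ENNReal.tsum_toReal_eq (fun n => ENNReal.ofReal_ne_top)]
  exact tsum_congr fun n => ENNReal.toReal_ofReal (by positivity)

lemma SupIntegrable.integrable {M : MarkovGameModel E Ω α K} {u : E → ℝ}
    (hα0 : 0 < α) (hα1 : α < 1) (hu : Measurable u) (h : M.SupIntegrable u) (x : E) (n : ℕ) :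
    Integrable (fun ω => u (M.X n ω)) (M.P x) := by
  have hX := M.measurable_X
  have hn : Integrable (fun ω => α ^ n * u (M.X n ω)) (M.P x) := by
    refine (h.integrable_tsum hα0 hα1 hu x).mono'
      (Measurable.aestronglyMeasurable (by fun_prop)) ?_
    filter_upwards [h.ae_summable hα0 hα1 hu x] with ω hω
    rw [Real.norm_eq_abs, abs_mul, abs_of_nonneg (pow_nonneg hα0.le n)]
    exact hω.le_tsum n fun _ _ => by positivity
  refine (hn.const_mul (α ^ n)⁻¹).congr ?_
  filter_upwards with ω
  field_simp

/-! ### The Markov property in terms of trajectories -/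

/-- The whole trajectory of the process. -/
def path (M : MarkovGameModel E Ω α K) (ω : Ω) (n : ℕ) : E := M.X n ω

lemma measurable_path (M : MarkovGameModel E Ω α K) : Measurable M.path :=
  measurable_pi_lambda _ M.measurable_X

/-- The trajectory frozen at time `n`. -/
def frozen (n : ℕ) (a : ℕ → E) (k : ℕ) : E := a (min k n)

lemma measurable_frozen (n : ℕ) : Measurable (frozen n : (ℕ → E) → ℕ → E) :=
  measurable_pi_lambda _ fun _ => measurable_pi_apply _

/-- The information contained in the process up to time `n`. -/
abbrev history (M : MarkovGameModel E Ω α K) (n : ℕ) : MeasurableSpace Ω :=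
  ⨆ k ≤ n, MeasurableSpace.comap (M.X k) inferInstance

lemma history_le (M : MarkovGameModel E Ω α K) (n : ℕ) : M.history n ≤ mΩ :=
  iSup₂_le fun k _ => (M.measurable_X k).comap_le

lemma measurable_history_frozen (M : MarkovGameModel E Ω α K) (n : ℕ) :
    Measurable[M.history n] fun ω => frozen n (M.path ω) := by
  refine @measurable_pi_lambda _ _ _ (M.history n) _ _ fun k => ?_
  exact (comap_measurable (M.X (min k n))).mono
    (le_iSup₂_of_le (f := fun (k : ℕ) (_ : k ≤ n) =>
      MeasurableSpace.comap (M.X k) inferInstance) (min k n) (min_le_right k n) le_rfl) le_rfl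

/-- The joint law of the trajectory up to time `n` and the state at time `n + 1`. -/
lemma map_frozen_prodMk (M : MarkovGameModel E Ω α K) [IsMarkovKernel K] (x : E) (n : ℕ) :
    (M.P x).map (fun ω => (frozen n (M.path ω), M.X (n + 1) ω)) =
      ((M.P x).map fun ω => frozen n (M.path ω)) ⊗ₘ K.comap (fun a => a n)
        (measurable_pi_apply n) := by
  have := M.isProbabilityMeasure x
  have hX := M.measurable_X
  have hfr : Measurable fun ω => frozen n (M.path ω) := (measurable_frozen n).comp M.measurable_path
  have : IsProbabilityMeasure ((M.P x).map fun ω => frozen n (M.path ω)) :=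
    Measure.isProbabilityMeasure_map hfr.aemeasurable
  refine Measure.ext_prod fun {s t} hs ht => ?_
  have hF := M.history_le n
  rw [Measure.map_apply (by fun_prop) (hs.prod ht), Measure.compProd_apply_prod hs ht,
    setLIntegral_map hs (Kernel.measurable_coe _ ht) hfr]
  -- Events of the frozen path belong to the history, so integrating the conditional probability
  -- over them yields the joint law on rectangles.
  have hA : MeasurableSet[M.history n] ((fun ω => frozen n (M.path ω)) ⁻¹' s) :=
    M.measurable_history_frozen n hs
  have h1 := setIntegral_condExp hF
    (f := (M.X (n + 1) ⁻¹' t).indicator (fun _ => (1 : ℝ))) (μ := M.P x)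
    ((integrable_const 1).indicator (hX _ ht)) hA
  have hmk : (M.P x)[(M.X (n + 1) ⁻¹' t).indicator (fun _ => (1 : ℝ)) | M.history n]
      =ᵐ[M.P x] fun ω => (K (M.X n ω) t).toReal := M.markov x n t ht
  rw [setIntegral_congr_ae (hF _ hA) (hmk.mono fun ω h _ => h),
    integral_indicator_const _ (hX _ ht)] at h1
  have hfrn (ω) : frozen n (M.path ω) n = M.X n ω := by simp [frozen, path]
  simp only [Kernel.comap_apply, hfrn]
  rw [← ENNReal.toReal_eq_toReal_iff' (measure_ne_top _ _), ← integral_toReal]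
  · rw [h1]
    simp [Measure.real, Measure.restrict_apply (hX _ ht)]
    rw [inter_comm]
    rfl
  · exact ((Kernel.measurable_coe _ ht).comp (hX n)).aemeasurable
  · exact ae_of_all _ fun ω => measure_lt_top _ _
  · exact ((setLIntegral_le_lintegral _ _).trans_lt ((lintegral_mono fun ω => prob_le_one).trans_lt
      (by simp))).ne

/-! ### Integrating out one randomization device -/

/-- All randomization devices outside of a given one. -/
def otherDevices (M : MarkovGameModel E Ω α K) (k : Fin 2 × ℕ) (ω : Ω)
    (l : ({k}ᶜ : Set (Fin 2 × ℕ))) : ℝ := M.ξ l.1.1 l.1.2 ω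

lemma measurable_otherDevices (M : MarkovGameModel E Ω α K) (k : Fin 2 × ℕ) :
    Measurable (M.otherDevices k) :=
  measurable_pi_lambda _ fun l => M.measurable_ξ l.1.1 l.1.2

lemma indepFun_otherDevices (M : MarkovGameModel E Ω α K) (x : E) (k : Fin 2 × ℕ) :
    IndepFun (M.ξ k.1 k.2) (M.otherDevices k) (M.P x) := by
  have h := indep_iSup_of_disjoint (fun l : Fin 2 × ℕ => (M.measurable_ξ l.1 l.2).comap_le)
    (M.indep_ξ x).iIndep (S := {k}) (T := {k}ᶜ) disjoint_compl_right
  refine indep_of_indep_of_le_right (indep_of_indep_of_le_left h ?_) ?_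
  · simp
  · rw [← measurable_iff_comap_le]
    refine @measurable_pi_lambda _ _ _ (_) _ _ fun l => ?_
    exact (comap_measurable (M.ξ l.1.1 l.1.2)).mono
      (le_iSup₂_of_le (f := fun (i : Fin 2 × ℕ) (_ : i ∈ ({k}ᶜ : Set _)) =>
        MeasurableSpace.comap (M.ξ i.1 i.2) inferInstance) l.1 l.2 le_rfl) le_rfl

lemma measure_device_le (M : MarkovGameModel E Ω α K) (x : E) (k : Fin 2 × ℕ) {c : ℝ}
    (h1 : c < 1) : M.P x (M.ξ k.1 k.2 ⁻¹' Iic c) = ENNReal.ofReal c := by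
  rw [(M.uniform_ξ x k.1 k.2).measure_preimage (by simp) (by simp) measurableSet_Iic]
  have : Ioo (0 : ℝ) 1 ∩ Iic c = Ioc 0 c := by
    ext y; simp only [mem_inter_iff, mem_Ioo, mem_Iic, mem_Ioc]
    constructor
    · rintro ⟨⟨a, b⟩, c⟩; exact ⟨a, c⟩
    · rintro ⟨a, b⟩; exact ⟨⟨a, b.trans_lt h1⟩, b⟩
  rw [this]
  simp

/-- Integrating out the randomization device that decides between the payoffs `u` and `v`,
for a fixed trajectory. -/
lemma integral_device (M : MarkovGameModel E Ω α K) (x : E) (k : Fin 2 × ℕ)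
    {B : Set (({k}ᶜ : Set (Fin 2 × ℕ)) → ℝ)} (hB : MeasurableSet B) {c : ℝ}
    (h0 : 0 < c) (h1 : c < 1) (u v : ℝ) :
    ∫ ω, (M.otherDevices k ⁻¹' B).indicator (fun ω => if M.ξ k.1 k.2 ω ≤ c then u else v) ω
      ∂(M.P x) = (M.P x).real (M.otherDevices k ⁻¹' B) * (c * u + (1 - c) * v) := by
  have := M.isProbabilityMeasure x
  have hBm := M.measurable_otherDevices k hB
  have hCm : MeasurableSet (M.ξ k.1 k.2 ⁻¹' Iic c) := M.measurable_ξ _ _ measurableSet_Iic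
  have hind : (M.P x).real (M.ξ k.1 k.2 ⁻¹' Iic c ∩ M.otherDevices k ⁻¹' B) =
      c * (M.P x).real (M.otherDevices k ⁻¹' B) := by
    rw [Measure.real, (M.indepFun_otherDevices x k).measure_inter_preimage_eq_mul _ _
      measurableSet_Iic hB, ENNReal.toReal_mul, M.measure_device_le x k h1,
      ENNReal.toReal_ofReal h0.le, Measure.real]
  -- Paying `v` on `B` and the surplus `u - v` where the device also falls below `c` leaves a single
  -- joint probability, which factors.
  have hsplit : (M.otherDevices k ⁻¹' B).indicator
      (fun ω => if M.ξ k.1 k.2 ω ≤ c then u else v) = fun ω =>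
      (M.otherDevices k ⁻¹' B).indicator (fun _ => v) ω +
      (M.ξ k.1 k.2 ⁻¹' Iic c ∩ M.otherDevices k ⁻¹' B).indicator (fun _ => u - v) ω := by
    funext ω
    by_cases hω : M.otherDevices k ω ∈ B <;> by_cases hc : M.ξ k.1 k.2 ω ≤ c <;>
      simp [indicator, hω, hc]
  rw [hsplit, integral_add ((integrable_const v).indicator hBm)
    ((integrable_const (u - v)).indicator (hCm.inter hBm)), integral_indicator_const _ hBm,
    integral_indicator_const _ (hCm.inter hBm), hind, smul_eq_mul, smul_eq_mul]
  ring

/-- Fubini for the independent pair (trajectory, devices), with `integral_device` on each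
trajectory. The payoffs may look into the future of the path, but the weight left by `B` depends
only on the path frozen at `n`; this lets the Markov property act afterwards. -/
lemma integral_stop_or_continue (M : MarkovGameModel E Ω α K) (x : E) (n : ℕ) (k : Fin 2 × ℕ)
    {B : Set ((ℕ → E) × (({k}ᶜ : Set (Fin 2 × ℕ)) → ℝ))} (hB : MeasurableSet B)
    {p : E → ℝ} (hpm : Measurable p) (hp : ∀ y, p y ∈ Ioo (0 : ℝ) 1)
    {u v : (ℕ → E) → ℝ} (hu : Measurable u) (hv : Measurable v)
    (hui : Integrable (fun ω => u (M.path ω)) (M.P x))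
    (hvi : Integrable (fun ω => v (M.path ω)) (M.P x)) :
    ∫ ω, ((fun ω => (frozen n (M.path ω), M.otherDevices k ω)) ⁻¹' B).indicator
      (fun ω => if M.ξ k.1 k.2 ω ≤ p (M.X n ω) then u (M.path ω) else v (M.path ω)) ω ∂(M.P x) =
    ∫ ω, (M.P x).real (M.otherDevices k ⁻¹' (Prod.mk (frozen n (M.path ω)) ⁻¹' B)) *
      (p (M.X n ω) * u (M.path ω) + (1 - p (M.X n ω)) * v (M.path ω)) ∂(M.P x) := by
  have := M.isProbabilityMeasure x
  have hpath := M.measurable_path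
  set Ξ : Ω → Fin 2 × ℕ → ℝ := fun ω l => M.ξ l.1 l.2 ω
  have hΞ : Measurable Ξ := measurable_pi_lambda _ fun l => M.measurable_ξ l.1 l.2
  let r : (Fin 2 × ℕ → ℝ) → (({k}ᶜ : Set (Fin 2 × ℕ)) → ℝ) := fun s l => s l.1
  have hr : Measurable r := measurable_pi_lambda _ fun l => measurable_pi_apply _
  let G : (ℕ → E) × (Fin 2 × ℕ → ℝ) → (ℕ → E) × (({k}ᶜ : Set (Fin 2 × ℕ)) → ℝ) :=
    fun z => (frozen n z.1, r z.2)
  have hG : Measurable G :=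
    ((measurable_frozen n).comp measurable_fst).prodMk (hr.comp measurable_snd)
  let φ : (ℕ → E) × (Fin 2 × ℕ → ℝ) → ℝ :=
    (G ⁻¹' B).indicator fun z => if z.2 k ≤ p (z.1 n) then u z.1 else v z.1
  have hφ : Measurable φ := by
    refine Measurable.indicator (Measurable.ite (measurableSet_le ?_ ?_) ?_ ?_) (hG hB)
    · exact (measurable_pi_apply k).comp measurable_snd
    · exact hpm.comp ((measurable_pi_apply n).comp measurable_fst)
    · exact hu.comp measurable_fst
    · exact hv.comp measurable_fst
  have hpair : Measurable fun ω => (M.path ω, Ξ ω) := hpath.prodMk hΞ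
  have hφint : Integrable (fun ω => φ (M.path ω, Ξ ω)) (M.P x) := by
    refine (hui.abs.add hvi.abs).mono' (hφ.comp hpair).aestronglyMeasurable (ae_of_all _ fun ω => ?_)
    simp only [φ, indicator, Pi.add_apply, Real.norm_eq_abs]
    have h1 := abs_nonneg (u (M.path ω))
    have h2 := abs_nonneg (v (M.path ω))
    split_ifs <;> simp <;> linarith
  have hlaw : (M.P x).map (fun ω => (M.path ω, Ξ ω)) =
      ((M.P x).map M.path).prod ((M.P x).map Ξ) :=
    (indepFun_iff_map_prod_eq_prod_map_map hpath.aemeasurable hΞ.aemeasurable).1 (M.indep_X_ξ x)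
  have : IsProbabilityMeasure ((M.P x).map Ξ) := Measure.isProbabilityMeasure_map hΞ.aemeasurable
  have : IsProbabilityMeasure ((M.P x).map M.path) :=
    Measure.isProbabilityMeasure_map hpath.aemeasurable
  have hφint' : Integrable φ (((M.P x).map M.path).prod ((M.P x).map Ξ)) := by
    rw [← hlaw]
    exact (integrable_map_measure hφ.aestronglyMeasurable hpair.aemeasurable).2 hφint
  have hinner (a : ℕ → E) : ∫ s, φ (a, s) ∂((M.P x).map Ξ) =
      (M.P x).real (M.otherDevices k ⁻¹' (Prod.mk (frozen n a) ⁻¹' B)) *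
        (p (a n) * u a + (1 - p (a n)) * v a) := by
    rw [integral_map hΞ.aemeasurable 
      (f := fun s => φ (a, s)) (hφ.comp measurable_prodMk_left).aestronglyMeasurable]
    exact M.integral_device x k (B := Prod.mk (frozen n a) ⁻¹' B) (measurable_prodMk_left hB)
      (c := p (a n)) (hp _).1 (hp _).2 (u a) (v a)
  have hfub := integral_prod φ hφint'
  have hinner' : (fun a => ∫ s, φ (a, s) ∂((M.P x).map Ξ)) = _ := funext hinner
  have hsm : StronglyMeasurable fun a => ∫ s, φ (a, s) ∂((M.P x).map Ξ) :=
    hφ.stronglyMeasurable.integral_prod_right'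
  rw [hinner'] at hfub hsm
  rw [← hlaw, integral_map hpair.aemeasurable hφ.aestronglyMeasurable,
    integral_map hpath.aemeasurable hsm.aestronglyMeasurable] at hfub
  exact hfub

/-! ### One-step indifference -/

/-- If the randomization makes the opponent indifferent, then for every event `B` which does not
depend on the device used by the player at time `n`, the expected gain on `B` of waiting one more
step vanishes. -/
lemma integral_increment_eq_zero (M : MarkovGameModel E Ω α K) [IsMarkovKernel K]
    (x : E) (n : ℕ) (k : Fin 2 × ℕ)
    {B : Set ((ℕ → E) × (({k}ᶜ : Set (Fin 2 × ℕ)) → ℝ))} (hB : MeasurableSet B)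
    {p f g : E → ℝ} (hpm : Measurable p) (hp : ∀ y, p y ∈ Ioo (0 : ℝ) 1)
    (hf : Measurable f) (hg : Measurable g)
    (hfi : ∀ n, Integrable (fun ω => f (M.X n ω)) (M.P x))
    (hgi : ∀ n, Integrable (fun ω => g (M.X n ω)) (M.P x))
    (hpfg : ∀ y, p y * g y + (1 - p y) * (α * kernelAction K f y) = f y) :
    ∫ ω, ((fun ω => (frozen n (M.path ω), M.otherDevices k ω)) ⁻¹' B).indicator
      (fun ω => if M.ξ k.1 k.2 ω ≤ p (M.X n ω) then α ^ n * g (M.X n ω) - α ^ n * f (M.X n ω)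
        else α ^ (n + 1) * f (M.X (n + 1) ω) - α ^ n * f (M.X n ω)) ω ∂(M.P x) = 0 := by
  have := M.isProbabilityMeasure x
  have hX := M.measurable_X
  refine (M.integral_stop_or_continue x n k hB hpm hp
    (u := fun a => α ^ n * g (a n) - α ^ n * f (a n))
    (v := fun a => α ^ (n + 1) * f (a (n + 1)) - α ^ n * f (a n)) (by fun_prop) (by fun_prop)
    (((hgi n).const_mul _).sub ((hfi n).const_mul _))
    (((hfi (n + 1)).const_mul _).sub ((hfi n).const_mul _))).trans ?_
  have hfr : Measurable fun ω => frozen n (M.path ω) := (measurable_frozen n).comp M.measurable_path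
  let w : (ℕ → E) → ℝ := fun b => (M.P x).real (M.otherDevices k ⁻¹' (Prod.mk b ⁻¹' B))
  have hw : Measurable w := by
    have h := measurable_measure_prodMk_left (ν := (M.P x).map (M.otherDevices k)) hB
    convert! h.ennreal_toReal using 2 with b
    rw [Measure.map_apply (M.measurable_otherDevices k) (measurable_prodMk_left hB)]
    rfl
  have hw1 (b) : ‖w b‖ ≤ 1 := by
    rw [Real.norm_of_nonneg measureReal_nonneg]; exact measureReal_le_one
  have hp1 (y) : ‖1 - p y‖ ≤ 1 := by
    rw [Real.norm_of_nonneg (by linarith [(hp y).2])]; linarith [(hp y).1]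
  have hp2 (y) : ‖p y‖ ≤ 1 := by
    rw [Real.norm_of_nonneg (hp y).1.le]; exact (hp y).2.le
  let ψ : (ℕ → E) × E → ℝ := fun z => w z.1 *
    (p (z.1 n) * (α ^ n * g (z.1 n) - α ^ n * f (z.1 n)) +
      (1 - p (z.1 n)) * (α ^ (n + 1) * f z.2 - α ^ n * f (z.1 n)))
  have hψ : Measurable ψ := by fun_prop
  have hpair : Measurable fun ω => (frozen n (M.path ω), M.X (n + 1) ω) := hfr.prodMk (hX _)
  have hfrn (ω) : frozen n (M.path ω) n = M.X n ω := by simp [frozen, path]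
  have hψint : Integrable (fun ω => ψ (frozen n (M.path ω), M.X (n + 1) ω)) (M.P x) := by
    simp only [ψ, hfrn]
    refine Integrable.bdd_mul (c := 1) (Integrable.add ?_ ?_)
      (hw.comp hfr).aestronglyMeasurable (ae_of_all _ fun ω => hw1 _)
    · exact (((hgi n).const_mul _).sub ((hfi n).const_mul _)).bdd_mul (c := 1)
        (hpm.comp (hX n)).aestronglyMeasurable (ae_of_all _ fun ω => hp2 _)
    · exact (((hfi (n + 1)).const_mul _).sub ((hfi n).const_mul _)).bdd_mul (c := 1)
        ((measurable_const.sub hpm).comp (hX n)).aestronglyMeasurable (ae_of_all _ fun ω => hp1 _)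
  have hlaw := M.map_frozen_prodMk x n
  have : IsProbabilityMeasure ((M.P x).map fun ω => frozen n (M.path ω)) :=
    Measure.isProbabilityMeasure_map hfr.aemeasurable
  have hψint' := (integrable_map_measure hψ.aestronglyMeasurable hpair.aemeasurable).2 hψint
  have hfint' := (integrable_map_measure (f := fun ω => (frozen n (M.path ω), M.X (n + 1) ω))
    (g := fun z : (ℕ → E) × E => f z.2)
    (hf.comp measurable_snd).aestronglyMeasurable hpair.aemeasurable).2 (hfi (n + 1))
  rw [hlaw] at hψint' hfint'
  -- Integrability of `f` under `K (a n)` is available only for almost every past `a`, which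
  -- suffices.
  have hae := ((Measure.integrable_compProd_iff
    (hf.comp measurable_snd).aestronglyMeasurable).1 hfint').1
  calc _ = ∫ ω, ψ (frozen n (M.path ω), M.X (n + 1) ω) ∂(M.P x) := by
        simp only [ψ, hfrn]; rfl
    _ = ∫ z, ψ z ∂((M.P x).map fun ω => (frozen n (M.path ω), M.X (n + 1) ω)) :=
        (integral_map hpair.aemeasurable hψ.aestronglyMeasurable).symm
    _ = ∫ a, ∫ y, ψ (a, y) ∂(K (a n)) ∂((M.P x).map fun ω => frozen n (M.path ω)) := by
        rw [hlaw, Measure.integral_compProd hψint']; rfl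
    _ = ∫ a, 0 ∂((M.P x).map fun ω => frozen n (M.path ω)) := by
        refine integral_congr_ae (hae.mono fun a ha => ?_)
        have ha : Integrable f (K (a n)) := ha
        simp only [ψ]
        have ha' : Integrable (fun y => (1 - p (a n)) * (α ^ (n + 1) * f y - α ^ n * f (a n)))
          (K (a n)) := ((ha.const_mul _).sub (integrable_const _)).const_mul _
        rw [integral_const_mul, integral_add (integrable_const _) ha', integral_const_mul,
          integral_const_mul, integral_sub (ha.const_mul _) (integrable_const _), integral_const_mul]
        simp only [integral_const, probReal_univ, one_smul]
        have h := hpfg (a n)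
        rw [kernelAction] at h
        rw [pow_succ]
        -- Given the past, the mean increment is `w a * α ^ n` times the defect in the indifference
        -- equation.
        linear_combination w a * α ^ n * h
    _ = 0 := by simp

/-! ### Markovian randomized times and their measurability -/

lemma markovTime_le_iff (M : MarkovGameModel E Ω α K) (i : Fin 2) (p : E → ℝ) (ω : Ω) (n : ℕ) :
    M.markovTime i p ω ≤ n ↔ ∃ m ≤ n, M.ξ i m ω ≤ p (M.X m ω) := by
  constructor
  · intro h
    by_contra! hc
    have : ((n + 1 : ℕ) : ℕ∞) ≤ M.markovTime i p ω :=
      le_iInf₂ fun m hm => by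
        rw [Nat.cast_le]
        by_contra! hlt
        exact absurd hm (not_le.2 (hc m (by omega)))
    exact absurd (this.trans h) (by rw [Nat.cast_le]; omega)
  · rintro ⟨m, hm, h⟩
    exact (iInf₂_le m h).trans (Nat.cast_le.2 hm)

lemma le_markovTime_iff (M : MarkovGameModel E Ω α K) (i : Fin 2) (p : E → ℝ) (ω : Ω) (n : ℕ) :
    n ≤ M.markovTime i p ω ↔ ∀ m < n, p (M.X m ω) < M.ξ i m ω := by
  constructor
  · intro h m hm
    by_contra! hc
    exact absurd (h.trans (iInf₂_le m hc)) (by rw [Nat.cast_le]; omega)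
  · intro h
    refine le_iInf₂ fun m hm => ?_
    rw [Nat.cast_le]
    by_contra! hlt
    exact absurd hm (not_le.2 (h m hlt))

lemma measurable_filtration_X (M : MarkovGameModel E Ω α K) (i : Fin 2) {m n : ℕ} (h : m ≤ n) :
    Measurable[M.filtration i n] (M.X m) :=
  (comap_measurable (M.X m)).mono (le_iSup₂_of_le (f := fun (k : ℕ) (_ : k ≤ n) =>
    MeasurableSpace.comap (M.X k) inferInstance ⊔ MeasurableSpace.comap (M.ξ i k) inferInstance)
    m h le_sup_left) le_rfl

lemma measurable_filtration_ξ (M : MarkovGameModel E Ω α K) (i : Fin 2) {m n : ℕ} (h : m ≤ n) :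
    Measurable[M.filtration i n] (M.ξ i m) :=
  (comap_measurable (M.ξ i m)).mono (le_iSup₂_of_le (f := fun (k : ℕ) (_ : k ≤ n) =>
    MeasurableSpace.comap (M.X k) inferInstance ⊔ MeasurableSpace.comap (M.ξ i k) inferInstance)
    m h le_sup_right) le_rfl

lemma admissible_markovTime (M : MarkovGameModel E Ω α K) (i : Fin 2) {p : E → ℝ}
    (hp : Measurable p) : M.Admissible i (M.markovTime i p) := by
  intro n
  have : {ω | M.markovTime i p ω ≤ (n : ℕ∞)} =
      ⋃ m ∈ Iic n, {ω | M.ξ i m ω ≤ p (M.X m ω)} := by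
    ext ω; simp [markovTime_le_iff]
  change MeasurableSet[M.filtration i n] {ω | M.markovTime i p ω ≤ (n : ℕ∞)}
  rw [this]
  refine MeasurableSet.biUnion (to_countable _) fun m hm => ?_
  exact @measurableSet_le _ _ _ _ _ (M.filtration i n) _ _ _ _ _ (M.measurable_filtration_ξ i hm)
    (hp.comp (M.measurable_filtration_X i hm))

/-- The information contained in the process up to time `n` and in all the devices except `k`. -/
abbrev historyExcept (M : MarkovGameModel E Ω α K) (k : Fin 2 × ℕ) (n : ℕ) : MeasurableSpace Ω :=
  MeasurableSpace.comap (fun ω => (frozen n (M.path ω), M.otherDevices k ω)) inferInstance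

/-- The event that neither a player using an admissible time nor the opponent using a Markovian
randomized time has stopped before the opponent's decision at time `n` does not depend on the
device of the opponent at time `n`. -/
lemma exists_continuation_event (M : MarkovGameModel E Ω α K) {i j : Fin 2} (hij : i ≠ j)
    {σ : Ω → ℕ∞} (hσ : M.Admissible i σ) {p : E → ℝ} (hp : Measurable p) (n : ℕ) :
    ∃ B : Set ((ℕ → E) × (({(j, n)}ᶜ : Set (Fin 2 × ℕ)) → ℝ)), MeasurableSet B ∧
      (fun ω => (frozen n (M.path ω), M.otherDevices (j, n) ω)) ⁻¹' B =
        {ω | n < σ ω ∧ n ≤ M.markovTime j p ω} := by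
  let T := fun ω => (frozen n (M.path ω), M.otherDevices (j, n) ω)
  have hT : Measurable[M.historyExcept (j, n) n] T := comap_measurable T
  have hXT (m : ℕ) (hm : m ≤ n) : Measurable[M.historyExcept (j, n) n] (M.X m) := by
    have : M.X m = fun ω => (T ω).1 m := by funext ω; simp [T, frozen, path, hm]
    rw [this]
    exact (measurable_pi_apply m).comp (measurable_fst.comp hT)
  have hξT (l : Fin 2 × ℕ) (hl : l ≠ (j, n)) : Measurable[M.historyExcept (j, n) n] (M.ξ l.1 l.2) :=
    (measurable_pi_apply (⟨l, hl⟩ : ({(j, n)}ᶜ : Set (Fin 2 × ℕ)))).comp (measurable_snd.comp hT)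
  -- Since `i ≠ j`, the player's own information never involves the device `(j, n)`.
  have hle : M.filtration i n ≤ M.historyExcept (j, n) n :=
    iSup₂_le fun m hm => sup_le (hXT m hm).comap_le
    (hξT (i, m) (by simp [hij])).comap_le
  have h1 : MeasurableSet[M.historyExcept (j, n) n] {ω | σ ω ≤ (n : ℕ∞)} := hle _ (hσ n)
  -- The weak inequality `n ≤ markovTime` matters: it involves only the opponent's devices at times
  -- `m < n`.
  have h2 : MeasurableSet[M.historyExcept (j, n) n] (⋂ m ∈ Iio n, {ω | p (M.X m ω) < M.ξ j m ω}) :=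
    MeasurableSet.biInter (to_countable _) fun m hm =>
      @measurableSet_lt _ _ _ _ _ (M.historyExcept (j, n) n) _ _ _ _ _
        (hp.comp (hXT m (le_of_lt hm)))
        (hξT (j, m) (by simpa using (ne_of_lt hm)))
  obtain ⟨B, hB, hBeq⟩ := h1.compl.inter h2
  refine ⟨B, hB, hBeq.trans ?_⟩
  ext ω
  simp [le_markovTime_iff]

/-! ### Truncated rewards and passage to the limit -/

/-- The payoff of stopping at `σ ∧ N` against an opponent stopping at `τ`, if simultaneous stopping
is paid like stopping first. -/
noncomputable def truncatedReward (M : MarkovGameModel E Ω α K) (f g : E → ℝ) (σ τ : Ω → ℕ∞)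
    (N : ℕ) (ω : Ω) : ℝ :=
  if τ ω < min (σ ω) N then α ^ (τ ω).toNat * g (M.X (τ ω).toNat ω)
  else α ^ (min (σ ω) N).toNat * f (M.X (min (σ ω) N).toNat ω)

lemma truncatedReward_zero (M : MarkovGameModel E Ω α K) (f g : E → ℝ) (σ τ : Ω → ℕ∞) (ω : Ω) :
    M.truncatedReward f g σ τ 0 ω = f (M.X 0 ω) := by
  simp [truncatedReward]

/-- Raising the horizon matters only if the player is still waiting after time `N` and the opponent
has not stopped before `N`. If the opponent stops at `N`, the tie paid by `f` becomes a payoff `g`;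
otherwise the payoff `f` moves from time `N` to `N + 1`. -/
lemma truncatedReward_succ (M : MarkovGameModel E Ω α K) (f g p : E → ℝ) (σ : Ω → ℕ∞) (j : Fin 2)
    (N : ℕ) (ω : Ω) :
    M.truncatedReward f g σ (M.markovTime j p) (N + 1) ω =
      M.truncatedReward f g σ (M.markovTime j p) N ω +
      {ω | N < σ ω ∧ N ≤ M.markovTime j p ω}.indicator
        (fun ω => if M.ξ j N ω ≤ p (M.X N ω) then α ^ N * g (M.X N ω) - α ^ N * f (M.X N ω)
          else α ^ (N + 1) * f (M.X (N + 1) ω) - α ^ N * f (M.X N ω)) ω := by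
  have key : (N : ℕ∞) ≤ M.markovTime j p ω →
      (M.ξ j N ω ≤ p (M.X N ω) ↔ M.markovTime j p ω = N) := by
    intro h
    rw [le_antisymm_iff, and_iff_left h, markovTime_le_iff]
    refine ⟨fun h' => ⟨N, le_rfl, h'⟩, fun ⟨m, hm, h'⟩ => ?_⟩
    rcases hm.lt_or_eq with hlt | rfl
    · exact absurd h' (not_le.2 ((M.le_markovTime_iff j p ω N).1 h m hlt))
    · exact h'
  generalize M.markovTime j p = τ at key ⊢
  simp only [truncatedReward, indicator, mem_ofPred_eq]
  generalize σ ω = s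
  generalize τ ω = t at key ⊢
  by_cases hs : (N : ℕ∞) < s
  · have hs' : ((N + 1 : ℕ) : ℕ∞) ≤ s := by
      simpa using Order.add_one_le_of_lt hs
    rw [min_eq_right hs', min_eq_right hs.le]
    by_cases ht : (N : ℕ∞) ≤ t
    · rw [if_neg (not_lt.2 ht : ¬ t < N), if_pos (⟨hs, ht⟩ : (N : ℕ∞) < s ∧ (N : ℕ∞) ≤ t)]
      by_cases hN : t = N
      · rw [if_pos ((key ht).2 hN)]
        subst hN
        rw [if_pos (Nat.cast_lt.2 (Nat.lt_succ_self N) : (N : ℕ∞) < ((N + 1 : ℕ) : ℕ∞))]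
        simp
      · have ht' : ((N + 1 : ℕ) : ℕ∞) ≤ t := by
          simpa using Order.add_one_le_of_lt (lt_of_le_of_ne ht (Ne.symm hN))
        rw [if_neg (not_lt.2 ht' : ¬ t < ((N + 1 : ℕ) : ℕ∞)), if_neg (mt (key ht).1 hN)]
        simp only [ENat.toNat_natCast]
        ring
    · have ht' := not_le.1 ht
      have ht'' : t < ((N + 1 : ℕ) : ℕ∞) := ht'.trans_le (Nat.cast_le.2 (Nat.le_succ N))
      simp only [ht, ht', ht'', and_false, if_true, if_false, add_zero]
  · have hs' := not_lt.1 hs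
    rw [min_eq_left hs', min_eq_left (hs'.trans (Nat.cast_le.2 (Nat.le_succ N)))]
    simp only [hs, false_and, if_false, add_zero]

lemma abs_truncatedReward_le (M : MarkovGameModel E Ω α K) (hα0 : 0 < α) (f g : E → ℝ)
    (σ τ : Ω → ℕ∞) (N : ℕ) {ω : Ω} (hf : Summable fun n : ℕ => α ^ n * |f (M.X n ω)|)
    (hg : Summable fun n : ℕ => α ^ n * |g (M.X n ω)|) :
    |M.truncatedReward f g σ τ N ω| ≤
      ∑' n : ℕ, α ^ n * |f (M.X n ω)| + ∑' n : ℕ, α ^ n * |g (M.X n ω)| := by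
  have h (u : E → ℝ) (hu : Summable fun n : ℕ => α ^ n * |u (M.X n ω)|) (n : ℕ) :
      |α ^ n * u (M.X n ω)| ≤ ∑' n : ℕ, α ^ n * |u (M.X n ω)| := by
    rw [abs_mul, abs_of_pos (pow_pos hα0 n)]
    exact hu.le_tsum n fun _ _ => by positivity
  have h0 (u : E → ℝ) : 0 ≤ ∑' n : ℕ, α ^ n * |u (M.X n ω)| := tsum_nonneg fun n => by positivity
  rw [truncatedReward]
  split_ifs
  · linarith [h g hg (τ ω).toNat, h0 f]
  · linarith [h f hf (min (σ ω) N).toNat, h0 g]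

/-- If either time is finite the sequence is eventually constant. If both are infinite it is `α ^ N
* f (X N)`, which vanishes in the limit by summability, in agreement with the reward `0`. -/
lemma tendsto_truncatedReward (M : MarkovGameModel E Ω α K) (f g : E → ℝ)
    (σ τ : Ω → ℕ∞) {ω : Ω} (hf : Summable fun n : ℕ => α ^ n * |f (M.X n ω)|) :
    Tendsto (fun N => M.truncatedReward f g σ τ N ω) atTop (𝓝 (M.reward f g f σ τ ω)) := by
  have hlim : Tendsto (fun n : ℕ => α ^ n * f (M.X n ω)) atTop (𝓝 0) := by
    rw [tendsto_zero_iff_abs_tendsto_zero]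
    have := hf.tendsto_atTop_zero.abs
    simpa [Function.comp_def, abs_mul] using this
  simp only [truncatedReward, reward]
  generalize σ ω = s
  generalize τ ω = t
  induction s using ENat.recTopCoe with
  | top =>
    induction t using ENat.recTopCoe with
    | top => simpa using hlim
    | coe t =>
      refine tendsto_const_nhds.congr' ?_
      filter_upwards [eventually_gt_atTop t] with N hN
      have : (t : ℕ∞) < N := Nat.cast_lt.2 hN
      simp [hN]
  | coe s =>
    refine tendsto_const_nhds.congr' ?_
    filter_upwards [eventually_ge_atTop s] with N hN
    rw [min_eq_left (Nat.cast_le.2 hN)]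
    rcases lt_trichotomy (s : ℕ∞) t with h | h | h
    · rw [if_pos h, if_neg (not_lt.2 h.le)]
    · rw [← h]; simp
    · rw [if_neg (not_lt.2 h.le), if_pos h, if_pos h]

/-- If the opponent's randomization makes a player indifferent, every admissible time yields the
same expected reward `f x`. -/
lemma integral_reward_markovTime (M : MarkovGameModel E Ω α K) [IsMarkovKernel K]
    (hα0 : 0 < α) (hα1 : α < 1) {p f g : E → ℝ} (hpm : Measurable p)
    (hp : ∀ y, p y ∈ Ioo (0 : ℝ) 1) (hf : Measurable f) (hg : Measurable g)
    (hfint : M.SupIntegrable f) (hgint : M.SupIntegrable g)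
    (hpfg : ∀ y, p y * g y + (1 - p y) * (α * kernelAction K f y) = f y)
    {i j : Fin 2} (hij : i ≠ j) {σ : Ω → ℕ∞} (hσ : M.Admissible i σ) (x : E) :
    ∫ ω, M.reward f g f σ (M.markovTime j p) ω ∂(M.P x) = f x := by
  have hX := M.measurable_X
  have hfi := hfint.integrable hα0 hα1 hf x
  have hgi := hgint.integrable hα0 hα1 hg x
  -- Every horizon gives the same expectation: at `N = 0` it is `f` at the starting point, and each
  -- increment integrates to zero.
  have hN (N : ℕ) : Integrable (M.truncatedReward f g σ (M.markovTime j p) N) (M.P x) ∧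
      ∫ ω, M.truncatedReward f g σ (M.markovTime j p) N ω ∂(M.P x) = f x := by
    induction N with
    | zero =>
      have h0 : M.truncatedReward f g σ (M.markovTime j p) 0 = fun ω => f (M.X 0 ω) :=
        funext fun ω => M.truncatedReward_zero f g σ _ ω
      rw [h0]
      refine ⟨hfi 0, ?_⟩
      rw [← integral_map (hX 0).aemeasurable hf.aestronglyMeasurable, M.initial x]
      exact integral_dirac' f x hf.stronglyMeasurable
    | succ N ih =>
      obtain ⟨B, hB, hBeq⟩ := M.exists_continuation_event hij hσ hpm N
      have hinc := M.integral_increment_eq_zero x N (j, N) hB hpm hp hf hg hfi hgi hpfg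
      rw [hBeq] at hinc
      have hmeas : MeasurableSet {ω | N < σ ω ∧ N ≤ M.markovTime j p ω} := by
        rw [← hBeq]
        exact (((measurable_frozen N).comp M.measurable_path).prodMk
          (M.measurable_otherDevices _)) hB
      have hint : Integrable ({ω | N < σ ω ∧ N ≤ M.markovTime j p ω}.indicator
          (fun ω => if M.ξ j N ω ≤ p (M.X N ω) then α ^ N * g (M.X N ω) - α ^ N * f (M.X N ω)
          else α ^ (N + 1) * f (M.X (N + 1) ω) - α ^ N * f (M.X N ω))) (M.P x) :=
        (Integrable.piecewise (s := {ω | M.ξ j N ω ≤ p (M.X N ω)})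
          (measurableSet_le (M.measurable_ξ j N) (hpm.comp (hX N)))
          (((hgi N).const_mul _).sub ((hfi N).const_mul _)).integrableOn
          (((hfi (N + 1)).const_mul _).sub ((hfi N).const_mul _)).integrableOn).indicator hmeas
      have hsucc := funext (M.truncatedReward_succ f g p σ j N)
      constructor
      · rw [hsucc]; exact ih.1.add hint
      · simp_rw [M.truncatedReward_succ f g p σ j N]
        rw [integral_add ih.1 hint, ih.2, hinc, add_zero]
  have hsf := hfint.ae_summable hα0 hα1 hf x
  have hsg := hgint.ae_summable hα0 hα1 hg x
  have hlim := tendsto_integral_of_dominated_convergence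
    (F := M.truncatedReward f g σ (M.markovTime j p)) (f := M.reward f g f σ (M.markovTime j p)) _
    (fun N => (hN N).1.aestronglyMeasurable)
    ((hfint.integrable_tsum hα0 hα1 hf x).add (hgint.integrable_tsum hα0 hα1 hg x))
    (fun N => by
      filter_upwards [hsf, hsg] with ω h1 h2
      exact M.abs_truncatedReward_le hα0 f g σ _ N h1 h2)
    (by
      filter_upwards [hsf] with ω h1
      exact M.tendsto_truncatedReward f g σ _ h1)
  simp_rw [fun N => (hN N).2] at hlim
  exact tendsto_nhds_unique hlim tendsto_const_nhds

end MarkovGameModel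

/-! ### The equilibrium -/

theorem mainTheorem12 {E Ω : Type*} [MeasurableSpace E] [MeasurableSpace Ω]
    (α : ℝ) (hα0 : 0 < α) (hα1 : α < 1)
    (K : Kernel E E) [IsMarkovKernel K] (M : MarkovGameModel E Ω α K)
    (f g h : E → ℝ) (hf : Measurable f) (hg : Measurable g) (hh : Measurable h)
    (hfint : M.SupIntegrable f) (hgint : M.SupIntegrable g) (hhint : M.SupIntegrable h)
    (hexc : StrictlyExcessive α K f) (hgf : ∀ x, f x < g x) (hfh : f = h)
    (p : E → ℝ)
    (hp : ∀ x, p x = (f x - α * kernelAction K f x) / (g x - α * kernelAction K f x)) :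
    (∀ x, p x ∈ Set.Ioo (0 : ℝ) 1) ∧
      M.IsGlobalMarkovianEquilibrium (fun _ => f) (fun _ => g) (fun _ => h) (fun _ => p) ∧
      ∀ i x, M.value (fun _ => f) (fun _ => g) (fun _ => h) (fun _ => p) i x = f x := by
  have hKf : Measurable (kernelAction K f) :=
    (hf.stronglyMeasurable.integral_kernel (κ := K)).measurable
  have hden (x : E) : 0 < g x - α * kernelAction K f x := by linarith [hexc x, hgf x]
  have hp01 (x : E) : p x ∈ Set.Ioo (0 : ℝ) 1 := by
    rw [hp]
    exact ⟨div_pos (by linarith [hexc x]) (hden x),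
      (div_lt_one (hden x)).2 (by linarith [hgf x])⟩
  have hpm : Measurable p := by
    rw [funext hp]
    exact (hf.sub (hKf.const_mul α)).div (hg.sub (hKf.const_mul α))
  have hpfg (x : E) : p x * g x + (1 - p x) * (α * kernelAction K f x) = f x := by
    have := (hden x).ne'
    rw [hp]
    field_simp
    ring
  have hrev (i : Fin 2) : i ≠ i.rev := by fin_cases i <;> decide
  subst hfh
  have hJ (i : Fin 2) (x : E) (σ : Ω → ℕ∞) (hσ : M.Admissible i σ) :
      M.J (fun _ => f) (fun _ => g) (fun _ => f) i x
        (Function.update (fun j => M.markovTime j p) i σ) = f x := by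
    rw [MarkovGameModel.J, Function.update_self, Function.update_of_ne (hrev i).symm]
    exact M.integral_reward_markovTime hα0 hα1 hpm hp01 hf hg hfint hgint hpfg (hrev i) hσ x
  have hval (i : Fin 2) (x : E) : M.J (fun _ => f) (fun _ => g) (fun _ => f) i x
      (fun j => M.markovTime j p) = f x := by
    -- Replacing a strategy by itself is a deviation that changes nothing.
    simpa using hJ i x (M.markovTime i p) (M.admissible_markovTime i hpm)
  refine ⟨hp01, ⟨fun _ => hpm, fun _ x => Set.Ioo_subset_Icc_self (hp01 x), fun x i =>
    ⟨M.admissible_markovTime i hpm, ?_⟩⟩, hval⟩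
  rw [hval]
  constructor
  · rintro _ ⟨σ, hσ, rfl⟩
    exact (hJ i x σ hσ).le
  · intro b hb
    exact hb ⟨M.markovTime i p, M.admissible_markovTime i hpm,
      (hJ i x _ (M.admissible_markovTime i hpm)).symm⟩
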